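/- **Setting.** Let $I$ be a finite set of players with $|I|\ge 2$; for each $i\in I$ let $S_i$ be a finite non-empty (discrete) strategy set and $\pi_i:S=\prod_{j}S_j\to\mathbb R$ a payoff function. For a family of sets $(Y_j)_{j\in I}$ write $Y_{-i}=\prod_{j\ne i}Y_j$. A *Souslin space* is a topological space that is the image of a complete separable metric space under a continuous surjection. For a topological space $X$, $\mathcal M(X)$ is the set of Borel probability measures on $X$ with the weak* (narrow) topology, i.e. the coarsest topology for which $\mu\mapsto\mu(U)$ is lower semicontinuous for every open $U\subseteq X$, and $\mathcal N(X)=\bigcup_{n\ge1}\mathcal M(X)^n$, with the direct sum topology, is the set of *lexicographic probability systems* (LPSs) $\bar\mu=(\mu^1,\dots,\mu^n)$. A Borel map $f:X\to Y$ induces $\hat f:\mathcal N(X)\to\mathcal N(Y)$, $\hat f(\mu^1,\dots,\mu^n)=(\mu^1\circ f^{-1},\dots,\mu^n\circ f^{-1})$; marginals of LPSs are the images under projections. A *type structure* is $\mathcal T=\langle S_i,T_i,\beta_i\rangle_{i\in I}$ where each $T_i$ is a Souslin space and each belief map $\beta_i:T_i\to\mathcal N(S_{-i}\times T_{-i})$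 is Borel measurable. **Hierarchies.** Let $X_i^1=S_{-i}$ and $X_i^{m+1}=X_i^m\times\prod_{j\ne i}\mathcal N(X_j^m)$. In a type structure let $\rho_{-i}^1:S_{-i}\times T_{-i}\to X_i^1$ be the projection, and for $m\ge1$ let $d_i^m(t_i)=\hat\rho_{-i}^{m}(\beta_i(t_i))\in\mathcal N(X_i^m)$ (the $m$-th order belief of $t_i$) and $\rho_{-i}^{m+1}=(\rho_{-i}^m,(d_j^m)_{j\ne i})$. A *hierarchy morphism* from $\mathcal T$ to $\mathcal T^\circ$ (type structures for the same game) is a family of (not necessarily measurable) maps $\varphi_i:T_i\to T_i^\circ$, $i \in I$, with $d_i^m(t_i)=d_i^{\circ,m}(\varphi_i(t_i))$ for all $i\in I$, $t_i\in T_i$, $m\ge1$. $\mathcal T$ and $\mathcal T^\circ$ are *hierarchy-equivalent* if there are hierarchy morphisms in both directions. **Epistemic events.** Let $\beta_i(t_i)=(\mu^1,\dots,\mu^n)$. A pair $(s_i,t_i)$ is *rational* if for every $s_i'\in S_i$ the vector $(\pi_i(s_i,\mathrm{marg}_{S_{-i}}\mu^l))_{l=1}^n$ of expected payoffs is lexicographically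 at least $(\pi_i(s_i',\mathrm{marg}_{S_{-i}}\mu^l))_{l=1}^n$; it is *cautiously rational* if moreover $\bigcup_{l\le n}\mathrm{Supp}\,\mathrm{marg}_{S_{-i}}\mu^l=S_{-i}$. The type $t_i$ *cautiously believes* a set $E\subseteq S_{-i}\times T_{-i}$ if for some $1\le k\le n$: (i) $\mu^l(E)=1$ for all $l\le k$; and (ii) for every $s_{-i}\in S_{-i}$ with $E\cap(\{s_{-i}\}\times T_{-i})\ne\emptyset$ there is $l\le k$ with $\mu^l(E\cap(\{s_{-i}\}\times T_{-i}))>0$. Let $R_i^0=S_i\times T_i$, let $R_i^1$ be the set of cautiously rational pairs, and for $m\ge1$ let $R_i^{m+1}$ be the set of $(s_i,t_i)\in R_i^m$ such that $t_i$ cautiously believes $\prod_{j\ne i}R_j^m$ (viewed as a subset of $S_{-i}\times T_{-i}$). Let $R_i^\infty=\bigcap_m R_i^m$ (cautious rationality and common cautious belief in cautious rationality). The sets $R_i^{\circ,m},R_i^{\circ,\infty}$ are defined in the same way in $\mathcal T^\circ$. **Theorem 1.** If $\mathcal T$ and $\mathcal T^\circ$ are hierarchy-equivalent type structures for the same finite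 game, then for every $i\in I$ and every $m\ge0$, $$\mathrm{Proj}_{S_i}(R_i^m)=\mathrm{Proj}_{S_i}(R_i^{\circ,m}),$$ and also $\mathrm{Proj}_{S_i}(R_i^\infty)=\mathrm{Proj}_{S_i}(R_i^{\circ,\infty})$. -/

import Mathlib

open Set MeasureTheory TopologicalSpace
open scoped ENNReal

universe u v w w'

/-- A Souslin space: a topological space that is the image of a complete separable metric
(i.e. Polish) space under a continuous surjection. -/
class SouslinSpace (X : Type*) [TopologicalSpace X] : Prop where
  exists_polish : ∃ (P : Type) (_ : TopologicalSpace P) (_ : PolishSpace P) (f : P → X),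
    Continuous f ∧ Function.Surjective f

/-- Borel maps: measurable for the Borel sigma-algebras of the two topologies. -/
def BorelMap {X Y : Type*} [TopologicalSpace X] [TopologicalSpace Y] (f : X → Y) : Prop :=
  @Measurable X Y (borel X) (borel Y) f

theorem BorelMap.of_continuous {X Y : Type*} [TopologicalSpace X] [TopologicalSpace Y]
    {f : X → Y} (hf : Continuous f) : BorelMap f := hf.borel_measurable

theorem BorelMap.comp {X Y Z : Type*} [TopologicalSpace X] [TopologicalSpace Y]
    [TopologicalSpace Z] {g : Y → Z} {f : X → Y} (hg : BorelMap g) (hf : BorelMap f) :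
    BorelMap (fun x => g (f x)) := by
  intro A hA
  exact hf (hg hA)

theorem BorelMap.prodMk {X Y Z : Type*} [TopologicalSpace X] [TopologicalSpace Y]
    [TopologicalSpace Z] [SecondCountableTopology Y] [SecondCountableTopology Z]
    {f : X → Y} {g : X → Z} (hf : BorelMap f) (hg : BorelMap g) :
    BorelMap (fun x => (f x, g x)) := by
  borelize X Y Z
  have h : Measurable (fun x => (f x, g x)) := Measurable.prodMk hf hg
  unfold BorelMap
  rw [← BorelSpace.measurable_eq (α := Y × Z)]
  exact h

theorem BorelMap.pi {X ι : Type*} [Countable ι] {Y : ι → Type*} [TopologicalSpace X]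
    [∀ j, TopologicalSpace (Y j)] [∀ j, SecondCountableTopology (Y j)]
    {f : X → ∀ j, Y j} (hf : ∀ j, BorelMap (fun x => f x j)) : BorelMap f := by
  let : MeasurableSpace X := borel X
  let : ∀ j, MeasurableSpace (Y j) := fun j => borel (Y j)
  have : ∀ j, BorelSpace (Y j) := fun j => ⟨rfl⟩
  have h : Measurable f := measurable_pi_iff.2 hf
  unfold BorelMap
  rw [← BorelSpace.measurable_eq (α := ∀ j, Y j)]
  exact h

theorem BorelMap.sigma_dom {ι : Type*} [Countable ι] {X : ι → Type*} {Y : Type*}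
    [∀ n, TopologicalSpace (X n)] [TopologicalSpace Y] {f : (Σ n, X n) → Y}
    (hf : ∀ n, BorelMap (fun x : X n => f ⟨n, x⟩)) : BorelMap f := by
  let : ∀ n, MeasurableSpace (X n) := fun n => borel (X n)
  have : ∀ n, BorelSpace (X n) := fun n => ⟨rfl⟩
  let m : MeasurableSpace (Σ n, X n) := borel (Σ n, X n)
  have : BorelSpace (Σ n, X n) := ⟨rfl⟩
  intro A hA
  have hU : f ⁻¹' A = ⋃ n, Sigma.mk n '' ((fun x : X n => f ⟨n, x⟩) ⁻¹' A) := by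
    ext ⟨n, x⟩
    simp only [mem_preimage, mem_iUnion, mem_image]
    constructor
    · intro h
      exact ⟨n, x, h, rfl⟩
    · rintro ⟨k, y, hy, he⟩
      rw [← he]
      exact hy
  rw [hU]
  exact MeasurableSet.iUnion fun n =>
    (Topology.IsOpenEmbedding.sigmaMk (σ := X) (i := n)).measurableEmbedding.measurableSet_image.2
      (hf n hA)

/-! ### Borel probability measures and lexicographic probability systems -/

/-- `BorelProb X` is the set of Borel probability measures on the topological space `X`. -/
structure BorelProb (X : Type*) [TopologicalSpace X] where
  /-- the underlying measure on the Borel sigma-algebra -/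
  toMeasure : @Measure X (borel X)
  isProbabilityMeasure : @IsProbabilityMeasure X (borel X) toMeasure

/-- The probability of a set. -/
noncomputable instance BorelProb.instCoeFun {X : Type*} [TopologicalSpace X] :
    CoeFun (BorelProb X) (fun _ => Set X → ℝ≥0∞) where
  coe μ := ⇑μ.toMeasure

/-- The weak* (narrow) topology: the coarsest topology for which `μ ↦ μ U` is lower
semicontinuous for every open `U`, equivalently for which `μ ↦ ∫ f dμ` is lower semicontinuous
for every bounded lower semicontinuous `f`. On a separable metrizable space this is the usual
topology of weak convergence, given by the bounded continuous functions. -/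
instance BorelProb.instTopologicalSpace {X : Type*} [TopologicalSpace X] :
    TopologicalSpace (BorelProb X) :=
  generateFrom {V | ∃ (U : Set X) (r : ℝ≥0∞), IsOpen U ∧ V = {μ : BorelProb X | r < μ U}}

theorem BorelProb.isOpen_lt {X : Type*} [TopologicalSpace X] {U : Set X} (hU : IsOpen U)
    (r : ℝ≥0∞) : IsOpen {μ : BorelProb X | r < μ U} :=
  isOpen_generateFrom_of_mem ⟨U, r, hU, rfl⟩

instance BorelProb.instSecondCountable {X : Type*} [TopologicalSpace X]
    [SecondCountableTopology X] : SecondCountableTopology (BorelProb X) := by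
  obtain ⟨D, hDc, hDd⟩ := exists_countable_dense ℝ≥0∞
  have := hDc.to_subtype
  have := (countable_countableBasis X).to_subtype
  let V : Finset (countableBasis X) × D → Set (BorelProb X) :=
    fun p => {μ : BorelProb X | (p.2 : ℝ≥0∞) < μ (⋃ b ∈ p.1, (b : Set X))}
  refine ⟨⟨range V, countable_range V, le_antisymm (le_generateFrom ?_) (le_generateFrom ?_)⟩⟩
  · rintro _ ⟨p, rfl⟩
    exact BorelProb.isOpen_lt
      (isOpen_biUnion fun b _ => isOpen_of_mem_countableBasis b.2) _
  · rintro _ ⟨U, r, hU, rfl⟩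
    have key : {μ : BorelProb X | r < μ U} =
        ⋃₀ {W | W ∈ range V ∧ W ⊆ {μ : BorelProb X | r < μ U}} := by
      refine Subset.antisymm ?_ (sUnion_subset fun W hW => hW.2)
      intro μ hμ
      obtain ⟨q, hqD, hrq, hqU⟩ := hDd.exists_between (show r < μ U from hμ)
      let : MeasurableSpace X := borel X
      let B := {b : countableBasis X // (b : Set X) ⊆ U}
      have hUB : U = ⋃ F : Finset B, ⋃ b ∈ F, (b.1 : Set X) := by
        refine Subset.antisymm (fun x hx => ?_) ?_
        · obtain ⟨b, hb, hxb, hbU⟩ := (isBasis_countableBasis X).exists_subset_of_mem_open hx hU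
          simp only [mem_iUnion]
          exact ⟨{⟨⟨b, hb⟩, hbU⟩}, ⟨⟨b, hb⟩, hbU⟩, Finset.mem_singleton_self _, hxb⟩
        · exact iUnion_subset fun F => iUnion₂_subset fun b _ => b.2
      have hdir : Directed (· ⊆ ·) fun F : Finset B => ⋃ b ∈ F, (b.1 : Set X) :=
        Monotone.directed_le fun F G hFG => biUnion_subset_biUnion_left hFG
      have hlt : q < ⨆ F : Finset B, μ (⋃ b ∈ F, (b.1 : Set X)) := by
        have h := hdir.measure_iUnion (μ := μ.1)
        rw [← hUB] at h
        exact lt_of_lt_of_eq hqU h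
      obtain ⟨F, hF⟩ := lt_iSup_iff.1 hlt
      have hFe : (⋃ b ∈ F.map (Function.Embedding.subtype _), (b : Set X)) =
          ⋃ b ∈ F, (b.1 : Set X) := by
        ext x
        simp [B]
      refine ⟨_, ⟨⟨(F.map (Function.Embedding.subtype _), ⟨q, hqD⟩), rfl⟩, ?_⟩, ?_⟩
      · intro ν hν
        simp only [V, hFe, mem_ofPred_eq] at hν
        exact (hrq.trans hν).trans_le (measure_mono (μ := ν.1) (iUnion₂_subset fun b _ => b.2))
      · simp only [V, hFe, mem_ofPred_eq]
        exact hF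
    rw [key]
    exact @isOpen_sUnion _ (generateFrom (range V)) _ fun W hW =>
      isOpen_generateFrom_of_mem hW.1

theorem BorelProb.borelMap_apply {X : Type*} [TopologicalSpace X] {A : Set X}
    (hA : MeasurableSet[borel X] A) : BorelMap (fun μ : BorelProb X => μ A) := by
  let : MeasurableSpace X := borel X
  have : BorelSpace X := ⟨rfl⟩
  let : MeasurableSpace (BorelProb X) := borel (BorelProb X)
  have : BorelSpace (BorelProb X) := ⟨rfl⟩
  unfold BorelMap
  rw [← BorelSpace.measurable_eq (α := ℝ≥0∞)]
  change Measurable (fun μ : BorelProb X => μ A)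
  induction A, hA using MeasurableSpace.induction_on_inter (rfl : borel X = _)
    isPiSystem_isOpen with
  | empty => simp
  | basic U hU => exact measurable_of_Ioi fun r => (BorelProb.isOpen_lt hU r).measurableSet
  | compl B hB ih =>
    have h : (fun μ : BorelProb X => μ Bᶜ) = fun μ => 1 - μ B := by
      funext μ
      have : IsProbabilityMeasure μ.1 := μ.2
      exact prob_compl_eq_one_sub hB
    rw [h]
    exact ih.const_sub 1
  | iUnion B hd hB ih =>
    have h : (fun μ : BorelProb X => μ (⋃ n, B n)) = fun μ => ∑' n, μ (B n) := by
      funext μ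
      exact measure_iUnion hd hB
    rw [h]
    exact Measurable.tsum ih

/-- The image measure of a Borel probability measure under a Borel map. -/
noncomputable def BorelProb.map {X Y : Type*} [TopologicalSpace X] [TopologicalSpace Y]
    (f : X → Y) (hf : BorelMap f) (μ : BorelProb X) : BorelProb Y :=
  ⟨@Measure.map X Y (borel X) (borel Y) f μ.1,
    @Measure.isProbabilityMeasure_map X Y (borel X) (borel Y) μ.1 μ.2 f
      (@Measurable.aemeasurable X Y (borel X) (borel Y) f μ.1 hf)⟩

theorem BorelProb.map_apply {X Y : Type*} [TopologicalSpace X] [TopologicalSpace Y]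
    {f : X → Y} (hf : BorelMap f) (μ : BorelProb X) {A : Set Y}
    (hA : MeasurableSet[borel Y] A) : BorelProb.map f hf μ A = μ (f ⁻¹' A) :=
  @Measure.map_apply X Y (borel X) (borel Y) μ.1 f hf A hA

theorem BorelProb.borelMap_map {X Y : Type*} [TopologicalSpace X] [TopologicalSpace Y]
    [SecondCountableTopology Y] {f : X → Y} (hf : BorelMap f) :
    BorelMap (BorelProb.map f hf) := by
  unfold BorelMap
  rw [borel_eq_generateFrom_of_subbasis (α := BorelProb Y) rfl]
  refine @measurable_generateFrom _ _ (borel _) _ _ ?_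
  rintro _ ⟨U, r, hU, rfl⟩
  have hU' : MeasurableSet[borel Y] U := MeasurableSpace.measurableSet_generateFrom hU
  have h : BorelProb.map f hf ⁻¹' {μ : BorelProb Y | r < μ U} =
      (fun μ : BorelProb X => μ (f ⁻¹' U)) ⁻¹' Ioi r := by
    ext μ
    simp only [mem_preimage, mem_ofPred_eq, mem_Ioi, BorelProb.map_apply hf μ hU']
  rw [h]
  exact BorelProb.borelMap_apply (hf hU') (MeasurableSpace.measurableSet_generateFrom (isOpen_Ioi (a := r)))

/-- `LPS X` is the set of lexicographic probability systems on `X`, that is, of finite sequences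
`(μ¹, …, μⁿ)`, `n ≥ 1`, of Borel probability measures on `X`. It carries the direct sum topology
of the product topologies on the sets of sequences of a given length. -/
abbrev LPS (X : Type*) [TopologicalSpace X] : Type _ :=
  Σ n : ℕ+, (Fin (n : ℕ) → BorelProb X)

/-- The length of an LPS. -/
def LPS.length {X : Type*} [TopologicalSpace X] (μ : LPS X) : ℕ := (μ.1 : ℕ)

/-- The image LPS map of a Borel map. -/
noncomputable def LPS.map {X Y : Type*} [TopologicalSpace X] [TopologicalSpace Y]
    (f : X → Y) (hf : BorelMap f) (μ : LPS X) : LPS Y :=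
  ⟨μ.1, fun l => BorelProb.map f hf (μ.2 l)⟩

theorem LPS.borelMap_map {X Y : Type*} [TopologicalSpace X] [TopologicalSpace Y]
    [SecondCountableTopology Y] {f : X → Y} (hf : BorelMap f) : BorelMap (LPS.map f hf) := by
  refine BorelMap.sigma_dom fun n => ?_
  have h1 : BorelMap (fun (μ : Fin (n : ℕ) → BorelProb X) (l : Fin (n : ℕ)) =>
      BorelProb.map f hf (μ l)) :=
    BorelMap.pi fun l =>
      (BorelProb.borelMap_map hf).comp (BorelMap.of_continuous (continuous_apply l))
  exact (BorelMap.of_continuous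
    (continuous_sigmaMk (σ := fun n : ℕ+ => Fin (n : ℕ) → BorelProb Y) (i := n))).comp h1

/-- The marginal on the first factor of an LPS on a product. -/
noncomputable def LPS.margFst {X Y : Type*} [TopologicalSpace X] [TopologicalSpace Y]
    (μ : LPS (X × Y)) : LPS X :=
  LPS.map Prod.fst (BorelMap.of_continuous continuous_fst) μ

/-- The support of a Borel probability measure: the smallest closed set of probability one. -/
def BorelProb.supp {X : Type*} [TopologicalSpace X] (μ : BorelProb X) : Set X :=
  ⋂₀ {C : Set X | IsClosed C ∧ μ C = 1}

/-- The support of an LPS. -/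
def LPS.supp {X : Type*} [TopologicalSpace X] (μ : LPS X) : Set X :=
  ⋃ l, (μ.2 l).supp

/-- Full-support LPSs. -/
def LPS.FullSupport {X : Type*} [TopologicalSpace X] (μ : LPS X) : Prop :=
  μ.supp = univ

/-! ### Type structures and hierarchies of beliefs -/

/-- `Others S i` is the product `S_{-i}` of the sets `S j` over the players `j ≠ i`. -/
abbrev Others {I : Type u} (S : I → Type v) (i : I) : Type (max u v) :=
  ∀ j : {j : I // j ≠ i}, S j

/-- Lexicographic type structures based on the strategy sets `S i`: every type space is a Souslin
space and every belief map `T i → LPS (S_{-i} × T_{-i})` is a Borel map. -/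
structure TypeStructure {I : Type u} (S : I → Type v) [∀ i, TopologicalSpace (S i)] where
  /-- the type spaces -/
  T : I → Type w
  [top : ∀ i, TopologicalSpace (T i)]
  souslin : ∀ i, SouslinSpace (T i)
  /-- the belief maps -/
  belief : ∀ i, T i → LPS (Others S i × Others T i)
  belief_borel : ∀ i, BorelMap (belief i)

attribute [instance] TypeStructure.top

section

variable {I : Type u} [Fintype I] (S : I → Type v) [∀ i, TopologicalSpace (S i)]

/-- The spaces underlying the hierarchies of beliefs. `hierSpace S m i` is the space of which
player `i`'s belief of order `m + 1` is an LPS: for `m = 0` it is `S_{-i}`, and the next space is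
the product of the present one with the LPSs of the other players on theirs. -/
def hierSpace : ℕ → I → TopCat.{max u v}
  | 0, i => TopCat.of (Others S i)
  | m + 1, i => TopCat.of (hierSpace m i × ∀ j : {j : I // j ≠ i}, LPS (hierSpace m j))

variable [∀ i, Fintype (S i)] [∀ i, DiscreteTopology (S i)]

instance hierSpace.instSecondCountable :
    ∀ (m : ℕ) (i : I), SecondCountableTopology (hierSpace S m i)
  | 0, i => inferInstanceAs (SecondCountableTopology (Others S i))
  | m + 1, i => by
    have := hierSpace.instSecondCountable m
    exact inferInstanceAs (SecondCountableTopology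
      (hierSpace S m i × ∀ j : {j : I // j ≠ i}, LPS (hierSpace S m j)))

end

namespace TypeStructure

section

variable {I : Type u} [Fintype I] {S : I → Type v} [∀ i, TopologicalSpace (S i)]
  [∀ i, Fintype (S i)] [∀ i, DiscreteTopology (S i)]

/-- The map that sends the strategies and types of the players other than `i` to the strategies
together with the beliefs of order at most `m` of these types, with its Borel measurability. -/
noncomputable def rho (𝒯 : TypeStructure.{u, v, w} S) : ∀ (m : ℕ) (i : I),
    {f : Others S i × Others 𝒯.T i → hierSpace S m i // BorelMap f}
  | 0, _ => ⟨fun p => p.1, BorelMap.of_continuous continuous_fst⟩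
  | m + 1, i =>
    ⟨fun p => ((𝒯.rho m i).1 p,
        fun j => LPS.map (𝒯.rho m j).1 (𝒯.rho m j).2 (𝒯.belief j (p.2 j))),
      (𝒯.rho m i).2.prodMk (BorelMap.pi fun j =>
        ((LPS.borelMap_map (𝒯.rho m j).2).comp (𝒯.belief_borel j)).comp
          (BorelMap.of_continuous ((continuous_apply j).comp continuous_snd)))⟩

/-- The hierarchy map: `𝒯.hier m i t` is the belief of order `m + 1` of the type `t` of
player `i`. For `m = 0` it is the marginal of `𝒯.belief i t` on `S_{-i}`. -/
noncomputable def hier (𝒯 : TypeStructure.{u, v, w} S) (m : ℕ) (i : I) (t : 𝒯.T i) :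
    LPS (hierSpace S m i) :=
  LPS.map (𝒯.rho m i).1 (𝒯.rho m i).2 (𝒯.belief i t)

/-- Hierarchy morphisms: families of (not necessarily measurable) maps between the type spaces
that preserve the beliefs of every order. -/
def IsHierarchyMorphism {𝒯 : TypeStructure.{u, v, w} S} {𝒯' : TypeStructure.{u, v, w'} S}
    (φ : ∀ i, 𝒯.T i → 𝒯'.T i) : Prop :=
  ∀ (i : I) (t : 𝒯.T i) (m : ℕ), 𝒯.hier m i t = 𝒯'.hier m i (φ i t)

/-- Two type structures are hierarchy-equivalent if there are hierarchy morphisms in both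
directions. -/
def HierarchyEquivalent (𝒯 : TypeStructure.{u, v, w} S) (𝒯' : TypeStructure.{u, v, w'} S) :
    Prop :=
  (∃ φ : ∀ i, 𝒯.T i → 𝒯'.T i, IsHierarchyMorphism φ) ∧
    ∃ ψ : ∀ i, 𝒯'.T i → 𝒯.T i, IsHierarchyMorphism ψ

end

end TypeStructure

/-! ### Cautious rationality and common cautious belief in cautious rationality -/

/-- The lexicographic order `x ≥_L y` on `ℝⁿ`. -/
def LexGE {n : ℕ} (x y : Fin n → ℝ) : Prop :=
  (∀ l, x l = y l) ∨ ∃ m, x m > y m ∧ ∀ l < m, x l = y l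

section

variable {I : Type u} [Fintype I] [DecidableEq I] {S : I → Type v}

/-- The strategy profile composed of a strategy of player `i` and strategies of the others. -/
def profile (i : I) (s : S i) (r : Others S i) : ∀ j, S j :=
  (Equiv.piSplitAt i S).symm (s, r)

variable [∀ i, Fintype (S i)] [∀ i, TopologicalSpace (S i)]

/-- The expected payoff of a strategy of player `i`, with payoff function `π`, under a belief
about the strategies of the others. -/
noncomputable def expPayoff {i : I} (π : (∀ j, S j) → ℝ) (s : S i)
    (μ : BorelProb (Others S i)) : ℝ :=
  ∑ r : Others S i, (μ {r}).toReal * π (profile i s r)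

/-- The strategy `s` of player `i` is optimal under an LPS on `S_{-i} × T_{-i}`. -/
def OptimalUnder {i : I} {Y : Type*} [TopologicalSpace Y] (π : (∀ j, S j) → ℝ) (s : S i)
    (μ : LPS (Others S i × Y)) : Prop :=
  ∀ s' : S i, LexGE (fun l => expPayoff π s (μ.margFst.2 l))
    (fun l => expPayoff π s' (μ.margFst.2 l))

end

/-- The event `E ⊆ S_{-i} × T_{-i}` is cautiously believed at level `m` under `μ`: the first `m`
measures give `E` probability one, and every elementary cylinder `{s} × T_{-i}` that meets `E`
does so in a set of positive probability under one of these measures. (The `l`-th measure of the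
sequence has index `l - 1`.) -/
def CautiouslyBelievedAt {X Y : Type*} [TopologicalSpace X] [TopologicalSpace Y]
    (μ : LPS (X × Y)) (E : Set (X × Y)) (m : ℕ) : Prop :=
  (∀ l : Fin (μ.1 : ℕ), (l : ℕ) < m → μ.2 l E = 1) ∧
    ∀ s : X, (E ∩ {s} ×ˢ univ).Nonempty →
      ∃ l : Fin (μ.1 : ℕ), (l : ℕ) < m ∧ 0 < μ.2 l (E ∩ {s} ×ˢ univ)

/-- `E` is cautiously believed under `μ` if it is so at some level between one and the length
of `μ`. -/
def CautiouslyBelieved {X Y : Type*} [TopologicalSpace X] [TopologicalSpace Y]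
    (μ : LPS (X × Y)) (E : Set (X × Y)) : Prop :=
  ∃ m : ℕ, 1 ≤ m ∧ m ≤ μ.length ∧ CautiouslyBelievedAt μ E m

namespace TypeStructure

section

variable {I : Type u} [Fintype I] [DecidableEq I] {S : I → Type v} [∀ i, Fintype (S i)]
  [∀ i, TopologicalSpace (S i)]

/-- A type is cautious if its first-order belief has full support. -/
def Cautious (𝒯 : TypeStructure.{u, v, w} S) {i : I} (t : 𝒯.T i) : Prop :=
  (𝒯.belief i t).margFst.FullSupport

/-- Rational strategy-type pairs, for the payoff functions `π`. -/
def Rational (𝒯 : TypeStructure.{u, v, w} S) (π : I → (∀ j, S j) → ℝ) {i : I}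
    (p : S i × 𝒯.T i) : Prop :=
  OptimalUnder (π i) p.1 (𝒯.belief i p.2)

/-- Cautiously rational strategy-type pairs. -/
def CautiouslyRational (𝒯 : TypeStructure.{u, v, w} S) (π : I → (∀ j, S j) → ℝ) {i : I}
    (p : S i × 𝒯.T i) : Prop :=
  𝒯.Rational π p ∧ 𝒯.Cautious p.2

/-- The strategy-type pairs of player `i` whose type cautiously believes `E`. -/
def cautiousBelief (𝒯 : TypeStructure.{u, v, w} S) (i : I)
    (E : Set (Others S i × Others 𝒯.T i)) : Set (S i × 𝒯.T i) :=
  {p | CautiouslyBelieved (𝒯.belief i p.2) E}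

/-- The product `∏_{j ≠ i} E j`, as a subset of `S_{-i} × T_{-i}`. -/
def othersEvent (𝒯 : TypeStructure.{u, v, w} S) (E : ∀ j, Set (S j × 𝒯.T j)) (i : I) :
    Set (Others S i × Others 𝒯.T i) :=
  {p | ∀ j : {j : I // j ≠ i}, (p.1 j, p.2 j) ∈ E j}

/-- The sets `R_i^m`: all strategy-type pairs for `m = 0`, the cautiously rational ones for
`m = 1`, and `R_i^{m+1}` is the set of pairs in `R_i^m` whose type cautiously believes
`∏_{j ≠ i} R_j^m`. -/
def R (𝒯 : TypeStructure.{u, v, w} S) (π : I → (∀ j, S j) → ℝ) :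
    ℕ → ∀ i : I, Set (S i × 𝒯.T i)
  | 0, _ => univ
  | 1, _ => {p | 𝒯.CautiouslyRational π p}
  | m + 2, i => 𝒯.R π (m + 1) i ∩ 𝒯.cautiousBelief i (𝒯.othersEvent (𝒯.R π (m + 1)) i)

/-- The set `R_i^∞`, the intersection of all `R_i^m`. -/
def Rinf (𝒯 : TypeStructure.{u, v, w} S) (π : I → (∀ j, S j) → ℝ) (i : I) :
    Set (S i × 𝒯.T i) :=
  ⋂ m : ℕ, 𝒯.R π m i

end

end TypeStructure

/-! ### Borel sets of lexicographic probability systems -/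

/-! A hierarchy does not by itself decide whether a type cautiously believes an event: clause (ii)
asks which cylinders meet the event, and this depends on which types the structure contains. But the
events in question are products over the opponents, so the cylinder over `r` meets one exactly when
every `r j` lies in the projection of player `j`'s set (`othersEvent_inter_cylinder_nonempty_iff`).
Once the projections at the earlier steps are fixed as parameters `P`, membership of `(s, t)` in `R
(m + 1)` says that `hier m i t` lies in a set `cautiousHierarchies π P m i s` defined without
reference to the type structure (`mem_R_succ_iff`).

Strong induction then gives the theorem: if the earlier projections agree, both structures are
tested against the same sets, so a hierarchy morphism carries `R m` into `R m` with the strategy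
unchanged, and the two morphisms give the two inclusions.

The sets of hierarchies must be Borel, since only then does an image measure give them the
probability of their preimage. The morphisms need not be measurable, as they are only applied to
single types. -/

theorem LPS.measurableSet_of_slices {X : Type*} [TopologicalSpace X] {s : Set (LPS X)}
    (h : ∀ n : ℕ+, MeasurableSet[borel (Fin (n : ℕ) → BorelProb X)]
      {ν | (⟨n, ν⟩ : LPS X) ∈ s}) : MeasurableSet[borel (LPS X)] s := by
  let : ∀ n : ℕ+, MeasurableSpace (Fin (n : ℕ) → BorelProb X) := fun n => borel _
  have : ∀ n : ℕ+, BorelSpace (Fin (n : ℕ) → BorelProb X) := fun n => ⟨rfl⟩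
  let : MeasurableSpace (LPS X) := borel (LPS X)
  have : BorelSpace (LPS X) := ⟨rfl⟩
  have hs : s = ⋃ n : ℕ+, Sigma.mk n '' {ν | (⟨n, ν⟩ : LPS X) ∈ s} := by
    ext ⟨n, ν⟩
    simp only [mem_iUnion, mem_image, mem_ofPred_eq]
    constructor
    · intro hν
      exact ⟨n, ν, hν, rfl⟩
    · rintro ⟨k, ν', hν', he⟩
      rwa [← he]
  rw [hs]
  exact MeasurableSet.iUnion fun n =>
    (Topology.IsOpenEmbedding.sigmaMk (σ := fun n : ℕ+ => Fin (n : ℕ) → BorelProb X)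
      (i := n)).measurableEmbedding.measurableSet_image.2 (h n)

/-- The sequences carry the Borel sigma-algebra of the product topology, hence the route through
continuity of the coordinate maps. -/
theorem BorelProb.measurable_coord_apply {X : Type*} [TopologicalSpace X] {n : ℕ} (l : Fin n)
    {A : Set X} (hA : MeasurableSet[borel X] A) :
    Measurable[borel (Fin n → BorelProb X)] (fun ν : Fin n → BorelProb X => ν l A) := by
  have h := (BorelProb.borelMap_apply hA).comp
    (BorelMap.of_continuous (continuous_apply (A := fun _ : Fin n => BorelProb X) l))
  unfold BorelMap at h
  rwa [← BorelSpace.measurable_eq (α := ℝ≥0∞)] at h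

theorem LPS.map_map {X Y Z : Type*} [TopologicalSpace X] [TopologicalSpace Y]
    [TopologicalSpace Z] {g : Y → Z} {f : X → Y} (hg : BorelMap g) (hf : BorelMap f)
    (μ : LPS X) : LPS.map g hg (LPS.map f hf μ) = LPS.map (fun x => g (f x)) (hg.comp hf) μ := by
  have h (ν : BorelProb X) : BorelProb.map g hg (BorelProb.map f hf ν) =
      BorelProb.map (fun x => g (f x)) (hg.comp hf) ν := by
    simp only [BorelProb.map, BorelProb.mk.injEq]
    exact @Measure.map_map X Y Z (borel X) (borel Y) (borel Z) ν.1 g f hg hf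
  simp only [LPS.map, h]

theorem measurableSet_lexGE {Ω : Type*} [MeasurableSpace Ω] {n : ℕ} {x y : Ω → Fin n → ℝ}
    (hx : ∀ l, Measurable fun ω => x ω l) (hy : ∀ l, Measurable fun ω => y ω l) :
    MeasurableSet {ω | LexGE (x ω) (y ω)} := by
  have heq (l : Fin n) : MeasurableSet {ω | x ω l = y ω l} := measurableSet_eq_fun (hx l) (hy l)
  refine MeasurableSet.union (s₁ := {ω | ∀ l, x ω l = y ω l})
    (s₂ := {ω | ∃ m, x ω m > y ω m ∧ ∀ l < m, x ω l = y ω l}) ?_ ?_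
  · rw [ofPred_forall]
    exact MeasurableSet.iInter heq
  · rw [ofPred_exists]
    refine MeasurableSet.iUnion fun m => MeasurableSet.inter
      (s₁ := {ω | x ω m > y ω m}) (s₂ := {ω | ∀ l < m, x ω l = y ω l})
      (measurableSet_lt (hy m) (hx m)) ?_
    simp only [ofPred_forall]
    exact MeasurableSet.iInter fun l => MeasurableSet.iInter fun _ => heq l

/-- Full support is a Borel condition on LPSs over a finite discrete space. -/
theorem LPS.measurableSet_fullSupport {X : Type*} [TopologicalSpace X] [Finite X]
    [DiscreteTopology X] : MeasurableSet[borel (LPS X)] {ν : LPS X | ν.FullSupport} := by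
  refine LPS.measurableSet_of_slices fun n => ?_
  let : MeasurableSpace (Fin (n : ℕ) → BorelProb X) := borel _
  -- A point lies in the support iff every set omitting it fails to have probability one. As `X` is
  -- finite and discrete, all sets are closed and there are finitely many of them.
  have hs : {ν : Fin (n : ℕ) → BorelProb X |
      (⟨n, ν⟩ : LPS X) ∈ {ν : LPS X | ν.FullSupport}} =
      ⋂ x : X, ⋃ l, ⋂ C : Set X, ⋂ _ : x ∉ C, {ν | ν l C = 1}ᶜ := by
    ext ν
    simp only [LPS.FullSupport, LPS.supp, BorelProb.supp, mem_ofPred_eq, eq_univ_iff_forall,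
      mem_iInter, mem_iUnion, mem_sInter, mem_compl_iff, isClosed_discrete, true_and]
    exact forall_congr' fun x => exists_congr fun l => forall_congr' fun C => not_imp_not.symm
  rw [hs]
  exact MeasurableSet.iInter fun x => MeasurableSet.iUnion fun l => MeasurableSet.iInter fun C =>
    MeasurableSet.iInter fun _ => (BorelProb.measurable_coord_apply l
      (MeasurableSpace.measurableSet_generateFrom (isOpen_discrete C))
        (measurableSet_singleton 1)).compl

/-! ### Projections of events to strategies. -/

namespace TypeStructure

/-- The event is a product, so witnessing types can be chosen for each opponent separately and
assembled into one profile. -/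
theorem othersEvent_inter_cylinder_nonempty_iff {I : Type u} {S : I → Type v}
    [∀ i, TopologicalSpace (S i)] (𝒯 : TypeStructure.{u, v, w} S)
    (E : ∀ j, Set (S j × 𝒯.T j)) (i : I) (r : Others S i) :
    (𝒯.othersEvent E i ∩ {r} ×ˢ univ).Nonempty ↔
      ∀ j : {j : I // j ≠ i}, r j ∈ Prod.fst '' E j := by
  constructor
  · rintro ⟨⟨r', t⟩, hE, hr, -⟩ j
    obtain rfl : r' = r := hr
    exact ⟨_, hE j, rfl⟩
  · intro h
    have h' (j : {j : I // j ≠ i}) : ∃ t, (r j, t) ∈ E j := by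
      obtain ⟨⟨_, t⟩, ht, rfl⟩ := h j
      exact ⟨t, ht⟩
    choose t ht using h'
    exact ⟨(r, t), ht, rfl, trivial⟩

theorem image_fst_subset_of_maps {I : Type u} {S : I → Type v} [∀ i, TopologicalSpace (S i)]
    {𝒯 : TypeStructure.{u, v, w} S} {𝒯' : TypeStructure.{u, v, w'} S}
    {E : ∀ i, Set (S i × 𝒯.T i)}
    {E' : ∀ i, Set (S i × 𝒯'.T i)}
    {φ : ∀ i, 𝒯.T i → 𝒯'.T i} {i : I} (h : ∀ s t, (s, t) ∈ E i → (s, φ i t) ∈ E' i) :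
    Prod.fst '' E i ⊆ Prod.fst '' E' i := by
  rintro _ ⟨⟨s, t⟩, hst, rfl⟩
  exact ⟨_, h s t hst, rfl⟩

end TypeStructure

/-! ### The events in the space of hierarchies -/

section

variable {I : Type u} {S : I → Type v} [∀ i, TopologicalSpace (S i)]

/-- The hierarchy with the last order dropped. -/
def hierSpace.init (m : ℕ) (i : I) (h : hierSpace S (m + 1) i) : hierSpace S m i :=
  Prod.fst (α := hierSpace S m i) (β := ∀ j : {j : I // j ≠ i}, LPS (hierSpace S m j)) h

/-- The beliefs of highest order of the other players. -/
def hierSpace.last (m : ℕ) (i : I) (h : hierSpace S (m + 1) i) (j : {j : I // j ≠ i}) :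
    LPS (hierSpace S m j) :=
  Prod.snd (α := hierSpace S m i) (β := ∀ j : {j : I // j ≠ i}, LPS (hierSpace S m j)) h j

theorem hierSpace.continuous_init (m : ℕ) (i : I) :
    Continuous (hierSpace.init (S := S) m i) :=
  continuous_fst (X := hierSpace S m i) (Y := ∀ j : {j : I // j ≠ i}, LPS (hierSpace S m j))

theorem hierSpace.continuous_last (m : ℕ) (i : I) (j : {j : I // j ≠ i}) :
    Continuous fun h => hierSpace.last (S := S) m i h j :=
  (continuous_apply j).comp (continuous_snd (X := hierSpace S m i)
    (Y := ∀ j : {j : I // j ≠ i}, LPS (hierSpace S m j)))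

/-- The strategies of the other players. -/
def hierSpace.strategies : ∀ (m : ℕ) (i : I), hierSpace S m i → Others S i
  | 0, _ => fun h => h
  | m + 1, i => fun h => hierSpace.strategies m i (hierSpace.init m i h)

theorem hierSpace.continuous_strategies : ∀ (m : ℕ) (i : I),
    Continuous (hierSpace.strategies (S := S) m i)
  | 0, i => continuous_id (X := Others S i)
  | m + 1, i => (hierSpace.continuous_strategies m i).comp (hierSpace.continuous_init m i)

/-- The hierarchies in which every other player's strategy and belief satisfy `B`. -/
def hierSpace.event {m : ℕ} (B : ∀ j, S j → Set (LPS (hierSpace S m j))) (i : I) :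
    Set (hierSpace S (m + 1) i) :=
  {h | ∀ j : {j : I // j ≠ i},
    hierSpace.last m i h j ∈ B j (hierSpace.strategies (m + 1) i h j)}

variable [∀ i, DiscreteTopology (S i)] [Fintype I]

theorem hierSpace.measurableSet_strategies_eq (m : ℕ) (i : I) (r : Others S i) :
    MeasurableSet[borel (hierSpace S m i)] {h | hierSpace.strategies m i h = r} :=
  MeasurableSpace.measurableSet_generateFrom
    ((isOpen_discrete {r}).preimage (hierSpace.continuous_strategies m i))

variable [∀ i, Fintype (S i)]

theorem hierSpace.measurableSet_event {m : ℕ} {B : ∀ j, S j → Set (LPS (hierSpace S m j))}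
    (hB : ∀ j s, MeasurableSet[borel _] (B j s)) (i : I) :
    MeasurableSet[borel (hierSpace S (m + 1) i)] (hierSpace.event B i) := by
  classical
  let : MeasurableSpace (hierSpace S (m + 1) i) := borel _
  -- The set `B j` to be tested varies with the strategy of `j`; it becomes constant on each of the
  -- finitely many pieces with a fixed strategy profile.
  have hE : hierSpace.event B i = ⋃ r : Others S i, {h | hierSpace.strategies (m + 1) i h = r} ∩
      ⋂ j : {j : I // j ≠ i}, (fun h => hierSpace.last m i h j) ⁻¹' B j (r j) := by
    ext h
    simp [hierSpace.event]
  rw [hE]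
  refine MeasurableSet.iUnion fun r => (hierSpace.measurableSet_strategies_eq (m + 1) i r).inter
    (MeasurableSet.iInter fun j => ?_)
  exact BorelMap.of_continuous (hierSpace.continuous_last m i j) (hB j (r j))

/-- The LPSs on hierarchies that cautiously believe `C`, where the elementary cylinders to be
charged are those over `Q`. -/
def hierSpace.cautiousBelief {m : ℕ} {i : I} (C : Set (hierSpace S m i)) (Q : Set (Others S i)) :
    Set (LPS (hierSpace S m i)) :=
  {ν | ∃ k : ℕ, 1 ≤ k ∧ k ≤ (ν.1 : ℕ) ∧ (∀ l : Fin (ν.1 : ℕ), (l : ℕ) < k → ν.2 l C = 1) ∧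
    ∀ r ∈ Q, ∃ l : Fin (ν.1 : ℕ), (l : ℕ) < k ∧
      0 < ν.2 l (C ∩ {h | hierSpace.strategies m i h = r})}

/-- For LPSs of a fixed length this is a countable combination of conditions on the numbers `ν l C`
and `ν l (C ∩ ...)`. `Q` may be arbitrary because there are finitely many strategy profiles. -/
theorem hierSpace.measurableSet_cautiousBelief {m : ℕ} {i : I} {C : Set (hierSpace S m i)}
    (hC : MeasurableSet[borel _] C) (Q : Set (Others S i)) :
    MeasurableSet[borel _] (hierSpace.cautiousBelief C Q) := by
  classical
  refine LPS.measurableSet_of_slices fun n => ?_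
  let : MeasurableSpace (Fin (n : ℕ) → BorelProb (hierSpace S m i)) := borel _
  have hCr (r : Others S i) :
      MeasurableSet[borel _] (C ∩ {h | hierSpace.strategies m i h = r}) :=
    @MeasurableSet.inter _ (borel _) _ _ hC (hierSpace.measurableSet_strategies_eq m i r)
  have hs : {ν : Fin (n : ℕ) → BorelProb (hierSpace S m i) |
      (⟨n, ν⟩ : LPS (hierSpace S m i)) ∈ hierSpace.cautiousBelief C Q} =
      ⋃ k : ℕ, ⋃ _ : 1 ≤ k, ⋃ _ : k ≤ (n : ℕ),
        (⋂ l : Fin (n : ℕ), ⋂ _ : (l : ℕ) < k, {ν | ν l C = 1}) ∩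
        ⋂ r : Others S i, ⋂ _ : r ∈ Q, ⋃ l : Fin (n : ℕ), ⋃ _ : (l : ℕ) < k,
          {ν | 0 < ν l (C ∩ {h | hierSpace.strategies m i h = r})} := by
    ext ν
    simp only [hierSpace.cautiousBelief, mem_ofPred_eq, mem_iUnion, mem_inter_iff, mem_iInter,
      exists_prop]
  rw [hs]
  refine MeasurableSet.iUnion fun k => MeasurableSet.iUnion fun _ => MeasurableSet.iUnion fun _ =>
    MeasurableSet.inter (MeasurableSet.iInter fun l => MeasurableSet.iInter fun _ => ?_)
      (MeasurableSet.iInter fun r => MeasurableSet.iInter fun _ => MeasurableSet.iUnion fun l =>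
        MeasurableSet.iUnion fun _ => ?_)
  · exact BorelProb.measurable_coord_apply l hC (measurableSet_singleton 1)
  · exact BorelProb.measurable_coord_apply l (hCr r) measurableSet_Ioi

/-! ### Hierarchies induced by types. -/

namespace TypeStructure

theorem strategies_rho (𝒯 : TypeStructure.{u, v, w} S) : ∀ (m : ℕ) (i : I)
    (p : Others S i × Others 𝒯.T i), hierSpace.strategies m i ((𝒯.rho m i).1 p) = p.1
  | 0, _, _ => rfl
  | m + 1, i, p => 𝒯.strategies_rho m i p

/-- Coherence of the hierarchy: `hierSpace.init m i` after `rho (m + 1) i` is `rho m i` by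
definition. -/
theorem map_init_hier (𝒯 : TypeStructure.{u, v, w} S) (m : ℕ) (i : I) (t : 𝒯.T i) :
    LPS.map (hierSpace.init m i) (BorelMap.of_continuous (hierSpace.continuous_init m i))
      (𝒯.hier (m + 1) i t) = 𝒯.hier m i t :=
  LPS.map_map _ _ _

theorem hier_apply (𝒯 : TypeStructure.{u, v, w} S) (m : ℕ) (i : I) (t : 𝒯.T i)
    (l : Fin ((𝒯.belief i t).1 : ℕ)) {C : Set (hierSpace S m i)}
    (hC : MeasurableSet[borel _] C) :
    (𝒯.hier m i t).2 l C = (𝒯.belief i t).2 l ((𝒯.rho m i).1 ⁻¹' C) :=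
  BorelProb.map_apply (𝒯.rho m i).2 _ hC

/-- The set `Q` supplies the one piece of information that the hierarchy lacks: which cylinders meet
the event in this type structure. -/
theorem hier_mem_cautiousBelief_iff (𝒯 : TypeStructure.{u, v, w} S) {m : ℕ} {i : I} {t : 𝒯.T i}
    {C : Set (hierSpace S m i)} (hC : MeasurableSet[borel _] C) {Q : Set (Others S i)}
    (hQ : ∀ r, r ∈ Q ↔ ((𝒯.rho m i).1 ⁻¹' C ∩ {r} ×ˢ univ).Nonempty) :
    𝒯.hier m i t ∈ hierSpace.cautiousBelief C Q ↔
      CautiouslyBelieved (𝒯.belief i t) ((𝒯.rho m i).1 ⁻¹' C) := by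
  have hcyl (r : Others S i) : (𝒯.rho m i).1 ⁻¹' (C ∩ {h | hierSpace.strategies m i h = r}) =
      (𝒯.rho m i).1 ⁻¹' C ∩ {r} ×ˢ univ := by
    ext p
    simp [𝒯.strategies_rho]
  have hCr (r : Others S i) :
      MeasurableSet[borel _] (C ∩ {h | hierSpace.strategies m i h = r}) :=
    @MeasurableSet.inter _ (borel _) _ _ hC (hierSpace.measurableSet_strategies_eq m i r)
  -- `LPS.map` keeps the length by definition, so the levels of the hierarchy are indexed by those
  -- of the belief.
  change (∃ k : ℕ, 1 ≤ k ∧ k ≤ ((𝒯.belief i t).1 : ℕ) ∧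
    (∀ l : Fin ((𝒯.belief i t).1 : ℕ), (l : ℕ) < k → (𝒯.hier m i t).2 l C = 1) ∧
    ∀ r ∈ Q, ∃ l : Fin ((𝒯.belief i t).1 : ℕ), (l : ℕ) < k ∧
      0 < (𝒯.hier m i t).2 l (C ∩ {h | hierSpace.strategies m i h = r})) ↔ _
  simp only [𝒯.hier_apply m i t _ hC, 𝒯.hier_apply m i t _ (hCr _), hcyl, hQ]
  rfl

end TypeStructure

/-! ### Steps of cautious rationality as Borel sets of LPSs. -/

variable [DecidableEq I]

/-- The first-order beliefs that are cautious and under which `s` is optimal. -/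
def cautiouslyRationalBeliefs (π : I → (∀ j, S j) → ℝ) (i : I) (s : S i) :
    Set (LPS (Others S i)) :=
  {ν | (∀ s', LexGE (fun l => expPayoff (π i) s (ν.2 l)) (fun l => expPayoff (π i) s' (ν.2 l))) ∧
    ν.FullSupport}

theorem measurableSet_cautiouslyRationalBeliefs (π : I → (∀ j, S j) → ℝ) (i : I) (s : S i) :
    MeasurableSet[borel _] (cautiouslyRationalBeliefs π i s) := by
  refine @MeasurableSet.inter _ (borel _) {ν : LPS (Others S i) | ∀ s', LexGE
    (fun l => expPayoff (π i) s (ν.2 l)) (fun l => expPayoff (π i) s' (ν.2 l))} _ ?_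
    LPS.measurableSet_fullSupport
  refine LPS.measurableSet_of_slices fun n => ?_
  let : MeasurableSpace (Fin (n : ℕ) → BorelProb (Others S i)) := borel _
  have hpay (s' : S i) (l : Fin (n : ℕ)) : Measurable
      fun ν : Fin (n : ℕ) → BorelProb (Others S i) => expPayoff (π i) s' (ν l) :=
    Finset.measurable_sum _ fun r _ => ((BorelProb.measurable_coord_apply l
      (MeasurableSpace.measurableSet_generateFrom (isOpen_discrete {r}))).ennreal_toReal).mul_const _
  have hs : {ν : Fin (n : ℕ) → BorelProb (Others S i) | (⟨n, ν⟩ : LPS (Others S i)) ∈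
      {ν : LPS (Others S i) | ∀ s', LexGE
        (fun l => expPayoff (π i) s (ν.2 l)) (fun l => expPayoff (π i) s' (ν.2 l))}} =
      ⋂ s', {ν | LexGE (fun l => expPayoff (π i) s (ν l)) (fun l => expPayoff (π i) s' (ν l))} := by
    ext ν
    simp only [mem_ofPred_eq, mem_iInter]
  rw [hs]
  exact MeasurableSet.iInter fun s' => measurableSet_lexGE (hpay s) (hpay s')

/-- The beliefs of order `m + 1` that make `s` consistent with `m + 1` steps of cautious
rationality and cautious belief in it, where `P k j` is taken as the set of strategies of player
`j` that are consistent with `k + 1` steps. -/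
def cautiousHierarchies (π : I → (∀ j, S j) → ℝ) (P : ℕ → ∀ j, Set (S j)) :
    ∀ (m : ℕ) (i : I), S i → Set (LPS (hierSpace S m i))
  | 0, i, s => cautiouslyRationalBeliefs π i s
  | m + 1, i, s =>
    LPS.map (hierSpace.init m i) (BorelMap.of_continuous (hierSpace.continuous_init m i)) ⁻¹'
        cautiousHierarchies π P m i s ∩
      hierSpace.cautiousBelief (hierSpace.event (cautiousHierarchies π P m) i)
        {r | ∀ j : {j : I // j ≠ i}, r j ∈ P m j}

theorem measurableSet_cautiousHierarchies (π : I → (∀ j, S j) → ℝ) (P : ℕ → ∀ j, Set (S j)) :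
    ∀ (m : ℕ) (i : I) (s : S i), MeasurableSet[borel _] (cautiousHierarchies π P m i s)
  | 0, i, s => measurableSet_cautiouslyRationalBeliefs π i s
  | m + 1, i, s => by
    have ih := measurableSet_cautiousHierarchies π P m
    exact @MeasurableSet.inter _ (borel _) _ _
      (LPS.borelMap_map (BorelMap.of_continuous (hierSpace.continuous_init m i)) (ih i s))
      (hierSpace.measurableSet_cautiousBelief (hierSpace.measurableSet_event ih i) _)

/-! ### Invariance under hierarchy morphisms. -/

namespace TypeStructure

/-- Membership in `R_i^{m+1}` depends on a type through its belief of order `m + 1` only, given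
the strategies consistent with the previous steps. -/
theorem mem_R_succ_iff (𝒯 : TypeStructure.{u, v, w} S) (π : I → (∀ j, S j) → ℝ)
    (P : ℕ → ∀ j, Set (S j)) : ∀ m : ℕ,
    (∀ k < m, ∀ j, Prod.fst '' 𝒯.R π (k + 1) j = P k j) → ∀ (i : I) (s : S i) (t : 𝒯.T i),
      (s, t) ∈ 𝒯.R π (m + 1) i ↔ 𝒯.hier m i t ∈ cautiousHierarchies π P m i s
  -- `hier 0` is by definition the marginal on strategies, on which both optimality and caution are
  -- stated.
  | 0, _, _, _, _ => Iff.rfl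
  | m + 1, hP, i, s, t => by
    have ih := 𝒯.mem_R_succ_iff π P m fun k hk => hP k (hk.trans m.lt_succ_self)
    -- By induction each opponent's membership is read off the last coordinate of `rho (m + 1)`, so
    -- the event is the preimage of a Borel set.
    have hE : 𝒯.othersEvent (𝒯.R π (m + 1)) i =
        (𝒯.rho (m + 1) i).1 ⁻¹' hierSpace.event (cautiousHierarchies π P m) i := by
      ext p
      refine forall_congr' fun j => ?_
      rw [ih, 𝒯.strategies_rho]
      rfl
    refine and_congr ?_ ?_
    · rw [ih, mem_preimage, 𝒯.map_init_hier]
    · rw [𝒯.hier_mem_cautiousBelief_iff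
        (hierSpace.measurableSet_event (measurableSet_cautiousHierarchies π P m) i), ← hE]
      · rfl
      · intro r
        rw [← hE, 𝒯.othersEvent_inter_cylinder_nonempty_iff]
        -- The induction hypothesis used the projections for `k < m`; the one for `k = m` enters
        -- only here, in the choice of cylinders.
        exact forall_congr' fun j => by rw [hP m m.lt_succ_self j.1]

variable {𝒯 : TypeStructure.{u, v, w} S} {𝒯' : TypeStructure.{u, v, w'} S}

/-- A hierarchy morphism preserves and reflects each `R_i^m` if the previous steps are consistent
with the same strategies in both type structures. -/
theorem IsHierarchyMorphism.mem_R_iff {φ : ∀ i, 𝒯.T i → 𝒯'.T i} (hφ : IsHierarchyMorphism φ)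
    (π : I → (∀ j, S j) → ℝ) {m : ℕ}
    (hP : ∀ k < m, ∀ j, Prod.fst '' 𝒯.R π k j = Prod.fst '' 𝒯'.R π k j)
    (i : I) (s : S i) (t : 𝒯.T i) : (s, t) ∈ 𝒯.R π m i ↔ (s, φ i t) ∈ 𝒯'.R π m i := by
  cases m with
  | zero => exact Iff.rfl
  | succ m =>
    -- The projections of `𝒯'` serve as `P` for both structures, so both hierarchies are tested
    -- against the same set.
    rw [𝒯.mem_R_succ_iff π (fun k j => Prod.fst '' 𝒯'.R π (k + 1) j) m
        fun k hk => hP _ (Nat.succ_lt_succ hk),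
      𝒯'.mem_R_succ_iff π (fun k j => Prod.fst '' 𝒯'.R π (k + 1) j) m fun _ _ _ => rfl,
      hφ i t m]

theorem HierarchyEquivalent.image_fst_R_eq (h : HierarchyEquivalent 𝒯 𝒯')
    (π : I → (∀ j, S j) → ℝ) (m : ℕ) :
    ∀ i, Prod.fst '' 𝒯.R π m i = Prod.fst '' 𝒯'.R π m i := by
  obtain ⟨⟨φ, hφ⟩, ψ, hψ⟩ := h
  induction m using Nat.strong_induction_on with
  | _ m ih =>
    exact fun i => Subset.antisymm
      (image_fst_subset_of_maps fun s t => (hφ.mem_R_iff π ih i s t).1)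
      (image_fst_subset_of_maps fun s t =>
        (hψ.mem_R_iff π (fun k hk j => (ih k hk j).symm) i s t).1)

/-- Equality of the projections at every finite step would not suffice, since the witnessing type
could change with `m`. A morphism sends one witness for all `m` to one witness for all `m`. -/
theorem HierarchyEquivalent.image_fst_Rinf_eq (h : HierarchyEquivalent 𝒯 𝒯')
    (π : I → (∀ j, S j) → ℝ) (i : I) :
    Prod.fst '' 𝒯.Rinf π i = Prod.fst '' 𝒯'.Rinf π i := by
  have hR := h.image_fst_R_eq π
  obtain ⟨⟨φ, hφ⟩, ψ, hψ⟩ := h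
  refine Subset.antisymm (image_fst_subset_of_maps (φ := φ) fun s t hst => ?_)
    (image_fst_subset_of_maps (φ := ψ) fun s t hst => ?_)
  · exact mem_iInter.2 fun m =>
      (hφ.mem_R_iff π (fun k _ => hR k) i s t).1 (mem_iInter.1 hst m)
  · exact mem_iInter.2 fun m =>
      (hψ.mem_R_iff π (fun k _ j => (hR k j).symm) i s t).1 (mem_iInter.1 hst m)

end TypeStructure

end

theorem theorem1 {I : Type u} [Fintype I] [DecidableEq I] [Nontrivial I]
    {S : I → Type v} [∀ i, Fintype (S i)] [∀ i, Nonempty (S i)]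
    [∀ i, TopologicalSpace (S i)] [∀ i, DiscreteTopology (S i)]
    (π : I → (∀ j, S j) → ℝ)
    (𝒯 : TypeStructure.{u, v, w} S) (𝒯' : TypeStructure.{u, v, w'} S)
    (h : TypeStructure.HierarchyEquivalent 𝒯 𝒯') (i : I) :
    (∀ m : ℕ, Prod.fst '' 𝒯.R π m i = Prod.fst '' 𝒯'.R π m i) ∧
      Prod.fst '' 𝒯.Rinf π i = Prod.fst '' 𝒯'.Rinf π i := by
  exact ⟨fun m => h.image_fst_R_eq π m i, h.image_fst_Rinf_eq π i⟩
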